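/- **Theorem 4.3 (relative convergence bound for subspace iteration).** All matrices are real. Let $0<k\le \ell<n\le m$ and $q\ge 0$ be integers, let $A$ be an $m\times n$ matrix, of any rank, and let $\Omega$ be an $n\times \ell$ matrix. Let $A=U\Sigma V^T$ be a singular value decomposition, with $U$ an $m\times n$ matrix with orthonormal columns, $V$ an $n\times n$ orthogonal matrix and $\Sigma=\mathrm{diag}(\sigma_1,\dots,\sigma_n)$, $\sigma_1\ge\dots\ge\sigma_n\ge 0$. Subspace iteration with input $A$, $\Omega$, $k$, $q$ forms $Y=(AA^T)^qA\,\Omega$, a matrix $Q$ whose columns are an orthonormal basis of the column space of $Y$, the matrix $B=Q^TA$, and a rank-$k$ truncated singular value decomposition $B_k$ of $B$ (an SVD of $B$ in which only the first $k$ terms are kept; $B_k=B$ if there are at most $k$ terms). It returns $QB_k$. Let $0\le p\le \ell-k$, and partition $$V^T\Omega=\begin{pmatrix}\widehat\Omega_1\\ \widehat\Omega_2\end{pmatrix},$$ where $\widehat\Omega_1$ consists of the first $\ell-p$ rows and $\widehat\Omega_2$ of the remaining $n-\ell+p$ rows. Assume that $\widehat\Omega_1$ has full row rank. Then, for every $j=1,\dots,k$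 and for every possible choice of $Q$ and $B_k$, $$\sigma_j\;\ge\;\sigma_j(B_k)\;\ge\;\frac{\sigma_j}{\sqrt{1+\|\widehat\Omega_2\|_2^2\,\|\widehat\Omega_1^{\dagger}\|_2^2\left(\dfrac{\sigma_{\ell-p+1}}{\sigma_j}\right)^{4q+2}}}.$$ Here $\sigma_j(X)$ is the $j$-th largest singular value of $X$ counted with multiplicity (taken as $0$ if $X$ has fewer than $j$ singular values), $\|\cdot\|_2$ is the spectral norm, $\widehat\Omega_1^{\dagger}$ is the Moore–Penrose pseudo-inverse, and if $\sigma_j=0$ the right-hand side is read as $0$. -/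

import Mathlib

open scoped Matrix Matrix.Norms.L2Operator

/-- `A = U diag(σ) Vᵀ` is a (thin) singular value decomposition of the real matrix `A`: the columns
of `U` and of `V` are orthonormal, and `σ` is nonincreasing and nonnegative. The entries of `σ` are
indexed from `0`, so `σ 0` is the largest singular value. -/
structure IsSVD {m n s : ℕ} (A : Matrix (Fin m) (Fin n) ℝ) (U : Matrix (Fin m) (Fin s) ℝ)
    (σ : Fin s → ℝ) (V : Matrix (Fin n) (Fin s) ℝ) : Prop where
  orthonormal_left : Uᵀ * U = 1
  orthonormal_right : Vᵀ * V = 1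
  antitone : Antitone σ
  nonneg : ∀ i, 0 ≤ σ i
  eq_mul : A = U * Matrix.diagonal σ * Vᵀ

/-- `C` is a rank-`k` truncated SVD of `B`: some SVD of `B` with all terms after the `k`-th
dropped. The SVD may have any number `s` of terms (necessarily `rank B ≤ s ≤ min r n`; the choice
of `s` only affects zero terms). Truncated SVDs need not be unique; if `k ≥ s`, nothing is
dropped. -/
def IsTruncatedSVD {r n : ℕ} (k : ℕ) (B C : Matrix (Fin r) (Fin n) ℝ) : Prop :=
  ∃ (s : ℕ) (W : Matrix (Fin r) (Fin s) ℝ) (τ : Fin s → ℝ) (Z : Matrix (Fin n) (Fin s) ℝ),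
    IsSVD B W τ Z ∧
      C = W * Matrix.diagonal (fun i : Fin s => if (i : ℕ) < k then τ i else 0) * Zᵀ

/-- The singular values of a real matrix in nonincreasing order with multiplicity, indexed from `0`
(and continued by zeros): `singularValue M i` is the `(i + 1)`-st largest singular value. -/
noncomputable def singularValue {m n : ℕ} (M : Matrix (Fin m) (Fin n) ℝ) (i : ℕ) : ℝ :=
  (Matrix.toEuclideanLin M).singularValues i

/-- One run of basic subspace iteration for `A` with start matrix `Ω`, power `q` and target rank
`k`: `Q` has orthonormal columns that form a basis of the column space of `Y = (A Aᵀ)^q A Ω`,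
`B = Qᵀ A`, and `Bk` is a rank-`k` truncated SVD of `B`. The output is `Q * Bk`.
The number `r` of columns of `Q` is then the rank of `Y`. -/
structure IsSubspaceIteration {m n ℓ r : ℕ} (A : Matrix (Fin m) (Fin n) ℝ)
    (Ω : Matrix (Fin n) (Fin ℓ) ℝ) (q k : ℕ) (Q : Matrix (Fin m) (Fin r) ℝ)
    (B Bk : Matrix (Fin r) (Fin n) ℝ) : Prop where
  orthonormal : Qᵀ * Q = 1
  colSpace : Submodule.span ℝ (Set.range Q.col) =
    Submodule.span ℝ (Set.range ((A * Aᵀ) ^ q * A * Ω).col)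
  eq_B : B = Qᵀ * A
  truncated : IsTruncatedSVD k B Bk

/-- The first `t` rows of a matrix. -/
def topRows {n ℓ : ℕ} (t : ℕ) (M : Matrix (Fin n) (Fin ℓ) ℝ) :
    Matrix {i : Fin n // (i : ℕ) < t} (Fin ℓ) ℝ :=
  M.submatrix Subtype.val id

/-- All rows of a matrix after the first `t`. -/
def bottomRows {n ℓ : ℕ} (t : ℕ) (M : Matrix (Fin n) (Fin ℓ) ℝ) :
    Matrix {i : Fin n // t ≤ (i : ℕ)} (Fin ℓ) ℝ :=
  M.submatrix Subtype.val id

/-- The four Penrose conditions: `X` is the Moore–Penrose inverse of `M`. -/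
structure IsMoorePenroseInverse {ι κ : Type*} [Fintype ι] [Fintype κ] (M : Matrix ι κ ℝ)
    (X : Matrix κ ι ℝ) : Prop where
  mul_mul_left : M * X * M = M
  mul_mul_right : X * M * X = X
  symm_left : (M * X)ᵀ = M * X
  symm_right : (X * M)ᵀ = X * M

theorem exists_isMoorePenroseInverse {ι κ : Type*} [Fintype ι] [Fintype κ] [DecidableEq κ]
    (M : Matrix ι κ ℝ) : ∃ X : Matrix κ ι ℝ, IsMoorePenroseInverse M X := by
  have hG : (Mᵀ * M).IsHermitian := by
    simpa [Matrix.conjTranspose_eq_transpose_of_trivial] using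
      Matrix.isHermitian_conjTranspose_mul_self M
  obtain ⟨P, hP1, hP2, hP3, hP4⟩ : ∃ P : Matrix κ κ ℝ,
      (Mᵀ * M) * P * (Mᵀ * M) = Mᵀ * M ∧ P * (Mᵀ * M) * P = P ∧ Pᵀ = P ∧
        (P * (Mᵀ * M))ᵀ = P * (Mᵀ * M) := by
    have hs := hG.spectral_theorem
    set G := Mᵀ * M
    set d : κ → ℝ := hG.eigenvalues
    set V : Matrix κ κ ℝ := (hG.eigenvectorUnitary : Matrix κ κ ℝ) with hV
    have hVV : Vᵀ * V = 1 := by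
      have := Unitary.coe_star_mul_self hG.eigenvectorUnitary
      simpa [Matrix.star_eq_conjTranspose, Matrix.conjTranspose_eq_transpose_of_trivial] using this
    have hGd : G = V * Matrix.diagonal d * Vᵀ := by
      rw [Unitary.conjStarAlgAut_apply] at hs
      simpa [Matrix.star_eq_conjTranspose, Matrix.conjTranspose_eq_transpose_of_trivial,
        Function.comp_def] using hs
    have key : ∀ a b : κ → ℝ, (V * Matrix.diagonal a * Vᵀ) * (V * Matrix.diagonal b * Vᵀ) =
        V * Matrix.diagonal (fun i => a i * b i) * Vᵀ := by
      intro a b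
      rw [← Matrix.diagonal_mul_diagonal]
      calc _ = V * Matrix.diagonal a * (Vᵀ * V) * Matrix.diagonal b * Vᵀ := by
            simp only [Matrix.mul_assoc]
        _ = _ := by rw [hVV]; simp only [Matrix.mul_assoc, Matrix.one_mul]
    refine ⟨V * Matrix.diagonal (fun i => (d i)⁻¹) * Vᵀ, ?_, ?_, ?_, ?_⟩
    · rw [hGd, key, key]
      congr 3; ext i
      by_cases h : d i = 0 <;> simp [h]
    · rw [hGd, key, key]
      congr 3; ext i
      by_cases h : d i = 0 <;> simp [h]
    · simp [Matrix.transpose_mul, Matrix.mul_assoc]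
    · rw [hGd, key]
      simp [Matrix.transpose_mul, Matrix.mul_assoc]
  have hMG : M * (P * (Mᵀ * M)) = M := by
    have e : Mᵀ * (M * (P * (Mᵀ * M)) - M) = 0 := by
      rw [Matrix.mul_sub, sub_eq_zero]
      simpa only [Matrix.mul_assoc] using hP1
    have e' : (M * (P * (Mᵀ * M)) - M)ᵀ * M = 0 := by
      simpa only [Matrix.transpose_mul, Matrix.transpose_transpose, Matrix.transpose_zero] using
        congrArg Matrix.transpose e
    rw [← sub_eq_zero, ← Matrix.conjTranspose_mul_self_eq_zero,
      Matrix.conjTranspose_eq_transpose_of_trivial, Matrix.mul_sub, ← Matrix.mul_assoc, e',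
      Matrix.zero_mul, sub_self]
  refine ⟨P * Mᵀ, ?_, ?_, ?_, ?_⟩
  · simpa only [Matrix.mul_assoc] using hMG
  · have := congrArg (· * Mᵀ) hP2
    simpa only [Matrix.mul_assoc] using this
  · simp [Matrix.transpose_mul, hP3, Matrix.mul_assoc]
  · simpa only [Matrix.mul_assoc] using hP4

/-- The Moore–Penrose pseudo-inverse of a real matrix (the Penrose conditions determine it). -/
noncomputable def pseudoInverse {ι κ : Type*} [Fintype ι] [Fintype κ] [DecidableEq κ]
    (M : Matrix ι κ ℝ) : Matrix κ ι ℝ :=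
  Classical.choose (exists_isMoorePenroseInverse M)

/-! Upper bound: `Q` has orthonormal columns, so Bessel gives `|Qᵀ A x| ≤ |A x|`, and smaller
quadratic forms have smaller singular values (`padZero_le_padZero`). Truncation leaves the first `k`
values unchanged.

Lower bound: by Courant–Fischer for `Bᵀ` it suffices to find a `(j + 1)`-dimensional space of `y`
with `|Bᵀ y| ≥ c |y|`. Let `X` be a right inverse of the top block of `Vᵀ Ω`, let `e` live on the
first `j + 1` coordinates, and write `Y X e = U u` with `u = Σ^(2q+1) Vᵀ Ω X e`. The top block of
`u` is `Σ₁^(2q+1) e`, still supported on the first `j + 1` coordinates, and the squared norm of the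
bottom block is at most `δ` times that of the top, `δ` being the term added to `1` under the root
(`sum_bottom_le_mul_sum_top`). As `U u` lies in the range of `Q`, the vector `y = Qᵀ U u` satisfies
`|y| = |u|` and `Bᵀ y = Aᵀ U u`. Hence `|Bᵀ y|² = ∑ σᵢ² uᵢ² ≥ σⱼ² |u|² / (1 + δ)`
(`mul_dotProduct_le_sum`). Only `σⱼ` is ever inverted, so the rank of `A` does not matter. -/

open Matrix

/-- A finite sequence continued by zeros. -/
def padZero {s : ℕ} (τ : Fin s → ℝ) (j : ℕ) : ℝ := if h : j < s then τ ⟨j, h⟩ else 0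

theorem padZero_nonneg {s : ℕ} {τ : Fin s → ℝ} (h : ∀ i, 0 ≤ τ i) (j : ℕ) : 0 ≤ padZero τ j := by
  unfold padZero
  split_ifs
  exacts [h _, le_rfl]

/-- Place the entries of a vector of length `j + 1` at the indices `i` whose position `f i` is at
most `j`, and zeros elsewhere. -/
def spread {ι : Type*} (j : ℕ) (f : ι → ℕ) : (Fin (j + 1) → ℝ) →ₗ[ℝ] (ι → ℝ) where
  toFun v i := if h : f i < j + 1 then v ⟨f i, h⟩ else 0
  map_add' v w := by
    ext i
    by_cases h : f i < j + 1 <;>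
      simp only [h, dite_true, dite_false, Pi.add_apply, add_zero]
  map_smul' c v := by
    ext i
    by_cases h : f i < j + 1 <;>
      simp only [h, dite_true, dite_false, Pi.smul_apply, smul_zero, RingHom.id_apply]

theorem spread_apply_of_lt {ι : Type*} {j : ℕ} {f : ι → ℕ} (v : Fin (j + 1) → ℝ) {i : ι}
    (h : j < f i) : spread j f v i = 0 :=
  dif_neg (by omega)

theorem spread_ne_zero {ι : Type*} {j : ℕ} {f : ι → ℕ} (hf : ∀ a : Fin (j + 1), ∃ i, f i = a)
    {v : Fin (j + 1) → ℝ} (hv : v ≠ 0) : spread j f v ≠ 0 := by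
  intro h
  apply hv
  ext ⟨a, ha⟩
  obtain ⟨i, hi⟩ := hf ⟨a, ha⟩
  obtain rfl : f i = a := hi
  have h1 : spread j f v i = v ⟨f i, ha⟩ := dif_pos ha
  rw [← h1, h]
  rfl

/-! ### Euclidean norms as dot products -/

section DotProduct

variable {ι κ : Type*} [Fintype ι] [Fintype κ]

theorem dotProduct_mulVec_self (W : Matrix ι κ ℝ) (x : κ → ℝ) :
    (W *ᵥ x) ⬝ᵥ (W *ᵥ x) = x ⬝ᵥ ((Wᵀ * W) *ᵥ x) := by
  rw [← mulVec_mulVec, dotProduct_mulVec, ← mulVec_transpose, dotProduct_comm]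

theorem dotProduct_mulVec_self_of_orthonormal [DecidableEq κ] {W : Matrix ι κ ℝ} (hW : Wᵀ * W = 1)
    (x : κ → ℝ) : (W *ᵥ x) ⬝ᵥ (W *ᵥ x) = x ⬝ᵥ x := by
  rw [dotProduct_mulVec_self, hW, one_mulVec]

theorem dotProduct_self_nonneg' (x : ι → ℝ) : 0 ≤ x ⬝ᵥ x :=
  Finset.sum_nonneg fun i _ => mul_self_nonneg (x i)

theorem dotProduct_self_pos {x : ι → ℝ} (hx : x ≠ 0) : 0 < x ⬝ᵥ x :=
  (dotProduct_self_nonneg' x).lt_of_ne fun h => hx (dotProduct_self_eq_zero.1 h.symm)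

/-- Bessel's inequality for the orthonormal columns of `W`. -/
theorem dotProduct_transpose_mulVec_self_le [DecidableEq κ] {W : Matrix ι κ ℝ} (hW : Wᵀ * W = 1)
    (x : ι → ℝ) : (Wᵀ *ᵥ x) ⬝ᵥ (Wᵀ *ᵥ x) ≤ x ⬝ᵥ x := by
  -- The residual of the projection onto the columns of `W` has nonnegative squared norm; expand it.
  have h := dotProduct_self_nonneg' (x - W *ᵥ (Wᵀ *ᵥ x))
  have h1 : x ⬝ᵥ (W *ᵥ (Wᵀ *ᵥ x)) = (Wᵀ *ᵥ x) ⬝ᵥ (Wᵀ *ᵥ x) := by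
    rw [dotProduct_mulVec, ← mulVec_transpose]
  rw [sub_dotProduct, dotProduct_sub, dotProduct_sub, dotProduct_mulVec_self_of_orthonormal hW,
    dotProduct_comm (W *ᵥ _) x, h1] at h
  linarith

theorem dotProduct_self_eq_norm_sq (x : ι → ℝ) : x ⬝ᵥ x = ‖WithLp.toLp 2 x‖ ^ 2 := by
  rw [EuclideanSpace.norm_sq_eq]
  exact Finset.sum_congr rfl fun i _ => by simp [sq]

theorem dotProduct_mulVec_self_le_norm [DecidableEq κ] (K : Matrix ι κ ℝ) (x : κ → ℝ) :
    (K *ᵥ x) ⬝ᵥ (K *ᵥ x) ≤ ‖K‖ ^ 2 * (x ⬝ᵥ x) := by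
  have h := l2_opNorm_mulVec K (WithLp.toLp 2 x)
  rw [dotProduct_self_eq_norm_sq, dotProduct_self_eq_norm_sq, ← mul_pow]
  exact pow_le_pow_left₀ (norm_nonneg _) h 2

/-- `M * X` fixes the range of `M`, which full row rank makes the whole space. -/
theorem mul_eq_one_of_rank_eq_card [DecidableEq ι] {M : Matrix ι κ ℝ}
    {X : Matrix κ ι ℝ} (hX : M * X * M = M) (hM : M.rank = Fintype.card ι) : M * X = 1 := by
  have hs : Function.Surjective M.mulVecLin := by
    rw [← LinearMap.range_eq_top]
    apply Submodule.eq_top_of_finrank_eq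
    rw [Module.finrank_fintype_fun_eq_card]
    exact hM
  apply Matrix.mulVec_injective
  ext1 y
  obtain ⟨x, rfl⟩ := hs y
  rw [mulVecLin_apply, mulVec_mulVec, hX, one_mulVec]

end DotProduct

/-! ### Operations on singular value decompositions -/

theorem IsSVD.dotProduct_mulVec_self {m n s : ℕ} {M : Matrix (Fin m) (Fin n) ℝ}
    {U : Matrix (Fin m) (Fin s) ℝ} {τ : Fin s → ℝ} {V : Matrix (Fin n) (Fin s) ℝ}
    (h : IsSVD M U τ V) (x : Fin n → ℝ) :
    (M *ᵥ x) ⬝ᵥ (M *ᵥ x) = ∑ i, τ i ^ 2 * (Vᵀ *ᵥ x) i ^ 2 := by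
  have : M *ᵥ x = U *ᵥ (diagonal τ *ᵥ (Vᵀ *ᵥ x)) := by
    rw [h.eq_mul, mulVec_mulVec, mulVec_mulVec, Matrix.mul_assoc]
  rw [this, dotProduct_mulVec_self_of_orthonormal h.orthonormal_left]
  simp only [dotProduct, mulVec_diagonal]
  exact Finset.sum_congr rfl fun i _ => by ring

theorem IsSVD.transpose {m n s : ℕ} {M : Matrix (Fin m) (Fin n) ℝ}
    {U : Matrix (Fin m) (Fin s) ℝ} {τ : Fin s → ℝ} {V : Matrix (Fin n) (Fin s) ℝ}
    (h : IsSVD M U τ V) : IsSVD Mᵀ V τ U where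
  orthonormal_left := h.orthonormal_right
  orthonormal_right := h.orthonormal_left
  antitone := h.antitone
  nonneg := h.nonneg
  eq_mul := by
    rw [h.eq_mul]
    simp [Matrix.transpose_mul, Matrix.mul_assoc]

theorem IsSVD.truncate {m n s : ℕ} {M : Matrix (Fin m) (Fin n) ℝ}
    {U : Matrix (Fin m) (Fin s) ℝ} {τ : Fin s → ℝ} {V : Matrix (Fin n) (Fin s) ℝ}
    (h : IsSVD M U τ V) (k : ℕ) :
    IsSVD (U * diagonal (fun i : Fin s => if (i : ℕ) < k then τ i else 0) * Vᵀ) U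
      (fun i => if (i : ℕ) < k then τ i else 0) V where
  orthonormal_left := h.orthonormal_left
  orthonormal_right := h.orthonormal_right
  antitone := by
    intro a b hab
    have h1 : (a : ℕ) ≤ b := hab
    have h2 := h.antitone hab
    have h3 := h.nonneg a
    dsimp only
    split_ifs <;> first | omega | assumption | rfl
  nonneg i := by
    have := h.nonneg i
    split_ifs <;> first | assumption | rfl
  eq_mul := rfl

/-! ### Courant–Fischer and uniqueness of singular values -/

section MinMax

variable {m n s j : ℕ} {M : Matrix (Fin m) (Fin n) ℝ} {τ : Fin s → ℝ} {V : Matrix (Fin n) (Fin s) ℝ}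

/-- Only the terms with `i ≥ j` survive, and there `τ i ≤ τ j`. Assuming a diagonalized Gram form
instead of an SVD lets the same argument serve the eigenbasis in `exists_gram_singularValue`, which
comes without left singular vectors. -/
theorem dotProduct_mulVec_self_le_padZero (hV : Vᵀ * V = 1) (hanti : Antitone τ)
    (h0 : ∀ i, 0 ≤ τ i)
    (hM : ∀ x, (M *ᵥ x) ⬝ᵥ (M *ᵥ x) = ∑ i, τ i ^ 2 * (Vᵀ *ᵥ x) i ^ 2)
    {x : Fin n → ℝ} (hx : ∀ i : Fin s, (i : ℕ) < j → (Vᵀ *ᵥ x) i = 0) :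
    (M *ᵥ x) ⬝ᵥ (M *ᵥ x) ≤ padZero τ j ^ 2 * (x ⬝ᵥ x) := by
  refine le_trans ?_ (mul_le_mul_of_nonneg_left (dotProduct_transpose_mulVec_self_le hV x)
    (sq_nonneg _))
  rw [hM, dotProduct, Finset.mul_sum]
  refine Finset.sum_le_sum fun i _ => ?_
  rw [← sq]
  by_cases hi : (i : ℕ) < j
  · simp [hx i hi]
  · refine mul_le_mul_of_nonneg_right (pow_le_pow_left₀ (h0 i) ?_ 2) (sq_nonneg _)
    have hj : j < s := by omega
    rw [padZero, dif_pos hj]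
    exact hanti (Fin.le_def.2 (by simpa using hi))

/-- Dimension count: at most `j` linear conditions on `j + 1` unknowns. -/
theorem exists_ne_zero_transpose_mulVec_eq_zero (V : Matrix (Fin n) (Fin s) ℝ)
    (L : (Fin (j + 1) → ℝ) →ₗ[ℝ] (Fin n → ℝ)) :
    ∃ v, v ≠ 0 ∧ ∀ i : Fin s, (i : ℕ) < j → (Vᵀ *ᵥ L v) i = 0 := by
  let C : (Fin (j + 1) → ℝ) →ₗ[ℝ] (Fin j → ℝ) :=
    LinearMap.pi fun a => if h : (a : ℕ) < s then
      LinearMap.proj (⟨a, h⟩ : Fin s) ∘ₗ Vᵀ.mulVecLin ∘ₗ L else 0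
  have hC : C.ker ≠ ⊥ := LinearMap.ker_ne_bot_of_finrank_lt (by simp)
  obtain ⟨v, hv, hv0⟩ := Submodule.exists_mem_ne_zero_of_ne_bot hC
  refine ⟨v, hv0, fun i hi => ?_⟩
  simpa [C, mulVec_transpose] using congrFun (LinearMap.mem_ker.1 hv) ⟨i, hi⟩

/-- The lower half of the Courant–Fischer principle. -/
theorem le_padZero_of_forall (hV : Vᵀ * V = 1) (hanti : Antitone τ) (h0 : ∀ i, 0 ≤ τ i)
    (hM : ∀ x, (M *ᵥ x) ⬝ᵥ (M *ᵥ x) = ∑ i, τ i ^ 2 * (Vᵀ *ᵥ x) i ^ 2)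
    {c : ℝ} (L : (Fin (j + 1) → ℝ) →ₗ[ℝ] (Fin n → ℝ))
    (hL : ∀ v, v ≠ 0 → L v ≠ 0 ∧ c ^ 2 * (L v ⬝ᵥ L v) ≤ (M *ᵥ L v) ⬝ᵥ (M *ᵥ L v)) :
    c ≤ padZero τ j := by
  obtain ⟨v, hv, hvV⟩ := exists_ne_zero_transpose_mulVec_eq_zero V L
  obtain ⟨h1, h2⟩ := hL v hv
  have h3 := h2.trans (dotProduct_mulVec_self_le_padZero hV hanti h0 hM hvV)
  exact le_of_sq_le_sq (le_of_mul_le_mul_right h3 (dotProduct_self_pos h1)) (padZero_nonneg h0 j)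

/-- Domination of quadratic forms implies domination of the singular values. -/
theorem padZero_le_padZero {m' s' : ℕ} {N : Matrix (Fin m') (Fin n) ℝ} {τ' : Fin s' → ℝ}
    {V' : Matrix (Fin n) (Fin s') ℝ}
    (hV : Vᵀ * V = 1) (hanti : Antitone τ) (h0 : ∀ i, 0 ≤ τ i)
    (hM : ∀ x, (M *ᵥ x) ⬝ᵥ (M *ᵥ x) = ∑ i, τ i ^ 2 * (Vᵀ *ᵥ x) i ^ 2)
    (hV' : V'ᵀ * V' = 1) (hanti' : Antitone τ') (h0' : ∀ i, 0 ≤ τ' i)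
    (hN : ∀ x, (N *ᵥ x) ⬝ᵥ (N *ᵥ x) = ∑ i, τ' i ^ 2 * (V'ᵀ *ᵥ x) i ^ 2)
    (hle : ∀ x, (N *ᵥ x) ⬝ᵥ (N *ᵥ x) ≤ (M *ᵥ x) ⬝ᵥ (M *ᵥ x)) (j : ℕ) :
    padZero τ' j ≤ padZero τ j := by
  by_cases hj : j < s'
  swap
  · rw [padZero, dif_neg hj]
    exact padZero_nonneg h0 j
  rw [padZero, dif_pos hj]
  have hP0 : ∀ v, v ≠ 0 → spread j (fun i : Fin s' => (i : ℕ)) v ≠ 0 :=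
    fun v => spread_ne_zero fun a => ⟨⟨a, by omega⟩, rfl⟩
  -- Test space: the span of the first `j + 1` right singular vectors of `N`.
  refine le_padZero_of_forall hV hanti h0 hM (V'.mulVecLin ∘ₗ spread j fun i : Fin s' => (i : ℕ)) fun v hv => ?_
  have hn := dotProduct_mulVec_self_of_orthonormal hV' (spread j (fun i : Fin s' => (i : ℕ)) v)
  rw [LinearMap.comp_apply, mulVecLin_apply]
  constructor
  · intro h
    rw [h, dotProduct_zero] at hn
    exact (dotProduct_self_pos (hP0 v hv)).ne hn
  · refine le_trans ?_ (hle _)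
    rw [hN, hn, mulVec_mulVec, hV', one_mulVec, dotProduct, Finset.mul_sum]
    refine Finset.sum_le_sum fun i _ => ?_
    rw [← sq]
    by_cases hi : (i : ℕ) < j + 1
    · refine mul_le_mul_of_nonneg_right (pow_le_pow_left₀ (h0' _) (hanti' ?_) 2) (sq_nonneg _)
      exact Fin.le_def.2 (by simpa using Nat.lt_succ_iff.1 hi)
    · simp [spread_apply_of_lt (f := fun i : Fin s' => (i : ℕ)) v (by omega : j < (i : ℕ))]

/-- The Gram form of a matrix, diagonalized by the singular values of Mathlib. -/
theorem exists_gram_singularValue (M : Matrix (Fin m) (Fin n) ℝ) :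
    ∃ V : Matrix (Fin n) (Fin n) ℝ, Vᵀ * V = 1 ∧
      ∀ x, (M *ᵥ x) ⬝ᵥ (M *ᵥ x) =
        ∑ i : Fin n, singularValue M i ^ 2 * (Vᵀ *ᵥ x) i ^ 2 := by
  set T := Matrix.toEuclideanLin M with hT
  have hn : Module.finrank ℝ (EuclideanSpace ℝ (Fin n)) = n := by simp
  have hS := T.isSymmetric_adjoint_comp_self
  set b := hS.eigenvectorBasis hn with hb
  have hVx : ∀ x i, ((Matrix.of fun a i => b i a)ᵀ *ᵥ x) i = inner ℝ (b i) (WithLp.toLp 2 x) := by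
    intro x i
    simp [mulVec, dotProduct, PiLp.inner_apply, mul_comm]
  refine ⟨Matrix.of fun a i => b i a, ?_, fun x => ?_⟩
  · ext i i'
    have := orthonormal_iff_ite.1 b.orthonormal i i'
    rw [Matrix.one_apply, ← this]
    simp [Matrix.mul_apply, PiLp.inner_apply, mul_comm]
  · have h1 : (M *ᵥ x) ⬝ᵥ (M *ᵥ x) = inner ℝ (WithLp.toLp 2 x)
        ((LinearMap.adjoint T ∘ₗ T) (WithLp.toLp 2 x)) := by
      rw [LinearMap.comp_apply, LinearMap.adjoint_inner_right]
      rw [real_inner_self_eq_norm_sq, dotProduct_self_eq_norm_sq]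
      rfl
    -- Parseval in an eigenbasis of `T* T`, whose eigenvalues are the squared singular values.
    rw [h1, ← b.sum_inner_mul_inner]
    refine Finset.sum_congr rfl fun i _ => ?_
    rw [hVx, ← hS (b i), hS.apply_eigenvectorBasis hn, singularValue,
      T.sq_singularValues_fin hn, inner_smul_left, real_inner_comm]
    simp
    ring

theorem padZero_singularValue (M : Matrix (Fin m) (Fin n) ℝ) (j : ℕ) :
    padZero (fun i : Fin n => singularValue M i) j = singularValue M j := by
  unfold padZero
  split_ifs with h
  · rfl
  · exact (LinearMap.singularValues_of_finrank_le _ (by simpa using h)).symm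

theorem singularValue_nonneg (M : Matrix (Fin m) (Fin n) ℝ) (j : ℕ) : 0 ≤ singularValue M j :=
  LinearMap.singularValues_nonneg _ j

/-- The singular values are the entries of any singular value decomposition. -/
theorem IsSVD.singularValue_eq {U : Matrix (Fin m) (Fin s) ℝ} (h : IsSVD M U τ V) (j : ℕ) :
    singularValue M j = padZero τ j := by
  obtain ⟨V', hV', hM'⟩ := exists_gram_singularValue M
  have hanti : Antitone fun i : Fin n => singularValue M i :=
    fun a b hab => LinearMap.singularValues_antitone _ hab
  have h0 : ∀ i : Fin n, 0 ≤ singularValue M i := fun i => singularValue_nonneg M i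
  rw [← padZero_singularValue]
  exact le_antisymm
    (padZero_le_padZero h.orthonormal_right h.antitone h.nonneg h.dotProduct_mulVec_self
      hV' hanti h0 hM' (fun _ => le_rfl) j)
    (padZero_le_padZero hV' hanti h0 hM'
      h.orthonormal_right h.antitone h.nonneg h.dotProduct_mulVec_self (fun _ => le_rfl) j)

theorem IsTruncatedSVD.singularValue_eq {k : ℕ} {B C : Matrix (Fin m) (Fin n) ℝ}
    (h : IsTruncatedSVD k B C) (hj : j < k) : singularValue C j = singularValue B j := by
  obtain ⟨s, W, τ, Z, hB, rfl⟩ := h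
  rw [(hB.truncate k).singularValue_eq, hB.singularValue_eq]
  simp [padZero, hj]

end MinMax

/-! ### Subspace iteration in singular coordinates -/

section Iteration

variable {m n ℓ r : ℕ} {A : Matrix (Fin m) (Fin n) ℝ} {U : Matrix (Fin m) (Fin n) ℝ} {σ : Fin n → ℝ}
  {V : Matrix (Fin n) (Fin n) ℝ}

theorem IsSVD.power_mul (hA : IsSVD A U σ V) (q : ℕ) :
    (A * Aᵀ) ^ q * A = U * diagonal (fun i => σ i ^ (2 * q + 1)) * Vᵀ := by
  induction q with
  | zero => simpa using hA.eq_mul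
  | succ q ih =>
    have key : ∀ a b c : Fin n → ℝ, U * diagonal a * Vᵀ * (V * diagonal b * Uᵀ) *
        (U * diagonal c * Vᵀ) = U * diagonal (fun i => a i * b i * c i) * Vᵀ := by
      intro a b c
      calc _ = U * diagonal a * (Vᵀ * V) * diagonal b * (Uᵀ * U) * diagonal c * Vᵀ := by
            simp only [Matrix.mul_assoc]
        _ = _ := by
            rw [hA.orthonormal_left, hA.orthonormal_right]
            simp only [Matrix.mul_one]
            rw [Matrix.mul_assoc U, diagonal_mul_diagonal, Matrix.mul_assoc U, diagonal_mul_diagonal]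
    rw [pow_succ', Matrix.mul_assoc, ih, hA.transpose.eq_mul]
    conv_lhs => enter [1, 1]; rw [hA.eq_mul]
    rw [key]
    congr 3
    ext i
    ring

/-- `Q Qᵀ` is the identity on the range of `Q`, which is the range of `Y`. -/
theorem IsSubspaceIteration.mulVec_transpose_mulVec_eq {Ω : Matrix (Fin n) (Fin ℓ) ℝ} {q k : ℕ}
    {Q : Matrix (Fin m) (Fin r) ℝ} {B Bk : Matrix (Fin r) (Fin n) ℝ}
    (h : IsSubspaceIteration A Ω q k Q B Bk) (w : Fin ℓ → ℝ) :
    Q *ᵥ (Qᵀ *ᵥ (((A * Aᵀ) ^ q * A * Ω) *ᵥ w)) = ((A * Aᵀ) ^ q * A * Ω) *ᵥ w := by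
  have hw : ((A * Aᵀ) ^ q * A * Ω) *ᵥ w ∈ LinearMap.range Q.mulVecLin := by
    rw [range_mulVecLin, h.colSpace, ← range_mulVecLin]
    exact ⟨w, rfl⟩
  obtain ⟨z, hz⟩ := hw
  rw [← hz, mulVecLin_apply, mulVec_mulVec, mulVec_mulVec, Matrix.mul_assoc, h.orthonormal, Matrix.mul_one]

theorem IsSVD.dotProduct_transpose_mulVec (hA : IsSVD A U σ V) (u : Fin n → ℝ) :
    (Aᵀ *ᵥ (U *ᵥ u)) ⬝ᵥ (Aᵀ *ᵥ (U *ᵥ u)) = ∑ i, σ i ^ 2 * u i ^ 2 := by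
  rw [hA.transpose.dotProduct_mulVec_self, mulVec_mulVec, hA.orthonormal_left, one_mulVec]

/-- Restricting the quadratic form of `A` to the range of `Q` lowers the singular values. -/
theorem IsSVD.singularValue_transpose_mul_le (hA : IsSVD A U σ V) {Q : Matrix (Fin m) (Fin r) ℝ}
    (hQ : Qᵀ * Q = 1) {s : ℕ} {W : Matrix (Fin r) (Fin s) ℝ} {τ : Fin s → ℝ}
    {Z : Matrix (Fin n) (Fin s) ℝ} (hB : IsSVD (Qᵀ * A) W τ Z) (j : ℕ) :
    padZero τ j ≤ padZero σ j := by
  refine padZero_le_padZero hA.orthonormal_right hA.antitone hA.nonneg hA.dotProduct_mulVec_self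
    hB.orthonormal_right hB.antitone hB.nonneg hB.dotProduct_mulVec_self (fun x => ?_) j
  rw [← mulVec_mulVec]
  exact dotProduct_transpose_mulVec_self_le hQ _

/-- A vector whose first `t` entries are concentrated on the first `j + 1` ones and dominate
the remaining ones up to the factor `δ` has a large weighted norm. -/
theorem mul_dotProduct_le_sum {j t : ℕ} (hanti : Antitone σ) (h0 : ∀ i, 0 ≤ σ i) (hj : j < n)
    {u : Fin n → ℝ} (hu : ∀ i : Fin n, j < (i : ℕ) → (i : ℕ) < t → u i = 0) {δ : ℝ} (hδ : 0 ≤ δ)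
    (hbot : ∑ i : {i : Fin n // t ≤ (i : ℕ)}, u i ^ 2 ≤
      δ * ∑ i : {i : Fin n // (i : ℕ) < t}, u i ^ 2) :
    σ ⟨j, hj⟩ ^ 2 * (u ⬝ᵥ u) ≤ (1 + δ) * ∑ i, σ i ^ 2 * u i ^ 2 := by
  have split : ∀ f : Fin n → ℝ, ∑ i, f i = ∑ i : {i : Fin n // (i : ℕ) < t}, f i +
      ∑ i : {i : Fin n // t ≤ (i : ℕ)}, f i := by
    intro f
    rw [← Fintype.sum_subtype_add_sum_subtype (fun i : Fin n => (i : ℕ) < t) f]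
    congr 1
    exact Fintype.sum_equiv (Equiv.subtypeEquivRight fun i => by simp) _ _ fun i => rfl
  have h1 : u ⬝ᵥ u ≤ (1 + δ) * ∑ i : {i : Fin n // (i : ℕ) < t}, u i ^ 2 := by
    have : u ⬝ᵥ u = ∑ i, u i ^ 2 := Finset.sum_congr rfl fun i _ => (sq (u i)).symm
    rw [this, split]
    linarith
  have h2 : σ ⟨j, hj⟩ ^ 2 * ∑ i : {i : Fin n // (i : ℕ) < t}, u i ^ 2 ≤ ∑ i, σ i ^ 2 * u i ^ 2 := by
    rw [split, Finset.mul_sum]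
    refine le_add_of_le_of_nonneg (Finset.sum_le_sum fun i _ => ?_)
      (Finset.sum_nonneg fun i _ => by positivity)
    by_cases hi : j < (i.1 : ℕ)
    · simp [hu i.1 hi i.2]
    · exact mul_le_mul_of_nonneg_right (pow_le_pow_left₀ (h0 _)
        (hanti (Fin.le_def.2 (by simpa using hi))) 2) (sq_nonneg _)
  calc _ ≤ σ ⟨j, hj⟩ ^ 2 * ((1 + δ) * ∑ i : {i : Fin n // (i : ℕ) < t}, u i ^ 2) :=
        mul_le_mul_of_nonneg_left h1 (sq_nonneg _)
    _ = (1 + δ) * (σ ⟨j, hj⟩ ^ 2 * ∑ i : {i : Fin n // (i : ℕ) < t}, u i ^ 2) := by ring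
    _ ≤ _ := mul_le_mul_of_nonneg_left h2 (by linarith)

/-- If `e` vanishes beyond position `j`, the part of `diag(σ)^p K X e` below the first `t` rows is
dominated by `diag(σ)^p e`. -/
theorem sum_bottom_le_mul_sum_top {j t : ℕ} (hanti : Antitone σ) (h0 : ∀ i, 0 ≤ σ i) (hj : j < n)
    (ht : t < n) (hσ : 0 < σ ⟨j, hj⟩) (p : ℕ) (K : Matrix (Fin n) (Fin ℓ) ℝ)
    (X : Matrix (Fin ℓ) {i : Fin n // (i : ℕ) < t} ℝ)
    {e : {i : Fin n // (i : ℕ) < t} → ℝ} (he : ∀ i, j < (i.1 : ℕ) → e i = 0) :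
    ∑ i : {i : Fin n // t ≤ (i : ℕ)}, (σ i ^ p * (K *ᵥ (X *ᵥ e)) i) ^ 2 ≤
      ‖bottomRows t K‖ ^ 2 * ‖X‖ ^ 2 * (σ ⟨t, ht⟩ / σ ⟨j, hj⟩) ^ (2 * p) *
        ∑ i : {i : Fin n // (i : ℕ) < t}, (σ i ^ p * e i) ^ 2 := by
  have h1 : ∑ i : {i : Fin n // t ≤ (i : ℕ)}, (σ i ^ p * (K *ᵥ (X *ᵥ e)) i) ^ 2 ≤
      σ ⟨t, ht⟩ ^ (2 * p) * (‖bottomRows t K‖ ^ 2 * (‖X‖ ^ 2 * (e ⬝ᵥ e))) := by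
    calc _ ≤ σ ⟨t, ht⟩ ^ (2 * p) *
          ((bottomRows t K *ᵥ (X *ᵥ e)) ⬝ᵥ (bottomRows t K *ᵥ (X *ᵥ e))) := by
          rw [dotProduct, Finset.mul_sum]
          refine Finset.sum_le_sum fun i _ => ?_
          rw [mul_pow, ← pow_mul, mul_comm p 2, ← sq]
          exact mul_le_mul_of_nonneg_right (pow_le_pow_left₀ (h0 _) (hanti (Fin.le_def.2 i.2)) _)
            (sq_nonneg _)
      _ ≤ _ := by
          refine mul_le_mul_of_nonneg_left ?_ (pow_nonneg (h0 _) _)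
          refine (dotProduct_mulVec_self_le_norm _ _).trans ?_
          exact mul_le_mul_of_nonneg_left (dotProduct_mulVec_self_le_norm _ _) (sq_nonneg _)
  have h2 : σ ⟨j, hj⟩ ^ (2 * p) * (e ⬝ᵥ e) ≤
      ∑ i : {i : Fin n // (i : ℕ) < t}, (σ i ^ p * e i) ^ 2 := by
    rw [dotProduct, Finset.mul_sum]
    refine Finset.sum_le_sum fun i _ => ?_
    rw [mul_pow, ← pow_mul, mul_comm p 2, ← sq]
    by_cases hi : j < (i.1 : ℕ)
    · simp [he i hi]
    · exact mul_le_mul_of_nonneg_right (pow_le_pow_left₀ (h0 _)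
        (hanti (Fin.le_def.2 (by simpa using hi))) _) (sq_nonneg _)
  refine h1.trans ?_
  have h3 := mul_le_mul_of_nonneg_left h2 (by
    have := h0 ⟨t, ht⟩
    positivity : 0 ≤ ‖bottomRows t K‖ ^ 2 * ‖X‖ ^ 2 * (σ ⟨t, ht⟩ / σ ⟨j, hj⟩) ^ (2 * p))
  refine le_trans (le_of_eq ?_) h3
  rw [div_pow]
  field_simp

end Iteration

/-! ### The lower bound and the theorem -/

theorem pseudoInverse_spec {ι κ : Type*} [Fintype ι] [Fintype κ] [DecidableEq κ]
    (M : Matrix ι κ ℝ) : IsMoorePenroseInverse M (pseudoInverse M) :=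
  Classical.choose_spec (exists_isMoorePenroseInverse M)

/-- The lower bound for the singular values of `Qᵀ A` in subspace iteration. -/
theorem IsSubspaceIteration.div_sqrt_le_padZero {m n ℓ r q k t j s : ℕ}
    {A : Matrix (Fin m) (Fin n) ℝ} {U : Matrix (Fin m) (Fin n) ℝ} {σ : Fin n → ℝ}
    {V : Matrix (Fin n) (Fin n) ℝ} (hA : IsSVD A U σ V) {Ω : Matrix (Fin n) (Fin ℓ) ℝ}
    {Q : Matrix (Fin m) (Fin r) ℝ} {B Bk : Matrix (Fin r) (Fin n) ℝ}
    (hrun : IsSubspaceIteration A Ω q k Q B Bk) (hjt : j < t) (ht : t < n)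
    (hσ : 0 < σ ⟨j, hjt.trans ht⟩)
    {X : Matrix (Fin ℓ) {i : Fin n // (i : ℕ) < t} ℝ} (hX : topRows t (Vᵀ * Ω) * X = 1)
    {W : Matrix (Fin r) (Fin s) ℝ} {τ : Fin s → ℝ} {Z : Matrix (Fin n) (Fin s) ℝ}
    (hB : IsSVD B W τ Z) :
    σ ⟨j, hjt.trans ht⟩ / √(1 + ‖bottomRows t (Vᵀ * Ω)‖ ^ 2 * ‖X‖ ^ 2 *
      (σ ⟨t, ht⟩ / σ ⟨j, hjt.trans ht⟩) ^ (4 * q + 2)) ≤ padZero τ j := by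
  set δ := ‖bottomRows t (Vᵀ * Ω)‖ ^ 2 * ‖X‖ ^ 2 *
      (σ ⟨t, ht⟩ / σ ⟨j, hjt.trans ht⟩) ^ (4 * q + 2) with hδ_def
  have hδ : 0 ≤ δ := by
    have := hA.nonneg ⟨t, ht⟩
    positivity
  set Y := (A * Aᵀ) ^ q * A * Ω with hY
  let L : (Fin (j + 1) → ℝ) →ₗ[ℝ] (Fin r → ℝ) := (Qᵀ * Y * X).mulVecLin ∘ₗ
    spread j fun i : {i : Fin n // (i : ℕ) < t} => (i.1 : ℕ)
  refine le_padZero_of_forall hB.orthonormal_left hB.antitone hB.nonneg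
    hB.transpose.dotProduct_mulVec_self L fun v hv => ?_
  set e := spread j (fun i : {i : Fin n // (i : ℕ) < t} => (i.1 : ℕ)) v with he_def
  have he : ∀ i : {i : Fin n // (i : ℕ) < t}, j < (i.1 : ℕ) → e i = 0 :=
    fun i hi => spread_apply_of_lt (f := fun i : {i : Fin n // (i : ℕ) < t} => (i.1 : ℕ)) v hi
  have he0 : e ≠ 0 := spread_ne_zero (fun a => ⟨⟨⟨a, by omega⟩, by
    have := a.2
    simp only
    omega⟩, rfl⟩) hv
  set u : Fin n → ℝ := fun i => σ i ^ (2 * q + 1) * ((Vᵀ * Ω) *ᵥ (X *ᵥ e)) i with hu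
  have hYu : Y *ᵥ (X *ᵥ e) = U *ᵥ u := by
    have : u = diagonal (fun i => σ i ^ (2 * q + 1)) *ᵥ ((Vᵀ * Ω) *ᵥ (X *ᵥ e)) := by
      ext i
      rw [mulVec_diagonal]
    rw [this, hY, hA.power_mul]
    simp only [mulVec_mulVec, Matrix.mul_assoc]
  have hLv : L v = Qᵀ *ᵥ (U *ᵥ u) := by
    rw [← hYu]
    simp only [L, LinearMap.comp_apply, mulVecLin_apply, mulVec_mulVec, ← he_def, Matrix.mul_assoc]
  have hQL : Q *ᵥ L v = U *ᵥ u := by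
    rw [hLv, ← hYu]
    exact hrun.mulVec_transpose_mulVec_eq (X *ᵥ e)
  have hLL : L v ⬝ᵥ L v = u ⬝ᵥ u := by
    rw [← dotProduct_mulVec_self_of_orthonormal hrun.orthonormal, hQL,
      dotProduct_mulVec_self_of_orthonormal hA.orthonormal_left]
  have hBL : Bᵀ *ᵥ L v = Aᵀ *ᵥ (U *ᵥ u) := by
    rw [← hQL, hrun.eq_B, mulVec_mulVec, Matrix.transpose_mul, Matrix.transpose_transpose]
  have htop : ∀ i : {i : Fin n // (i : ℕ) < t}, u i = σ i ^ (2 * q + 1) * e i := by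
    intro i
    have : (topRows t (Vᵀ * Ω) *ᵥ (X *ᵥ e)) i = e i := by rw [mulVec_mulVec, hX, one_mulVec]
    rw [← this]
    rfl
  have hbot : ∑ i : {i : Fin n // t ≤ (i : ℕ)}, u i ^ 2 ≤
      δ * ∑ i : {i : Fin n // (i : ℕ) < t}, u i ^ 2 := by
    simp only [htop]
    have := sum_bottom_le_mul_sum_top hA.antitone hA.nonneg (hjt.trans ht) ht hσ (2 * q + 1)
      (Vᵀ * Ω) X he
    rwa [show 2 * (2 * q + 1) = 4 * q + 2 by ring] at this
  have hu0 : ∀ i : Fin n, j < (i : ℕ) → (i : ℕ) < t → u i = 0 := fun i hi hit => by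
    rw [htop ⟨i, hit⟩, he ⟨i, hit⟩ hi, mul_zero]
  have hmain := mul_dotProduct_le_sum hA.antitone hA.nonneg (hjt.trans ht) hu0 hδ hbot
  constructor
  -- Injectivity of `L`: `u = 0` forces `e i = 0` for `i ≤ j`, because there `σ i ≥ σ j > 0`.
  · intro h
    rw [h, dotProduct_zero] at hLL
    have hu_zero : u = 0 := dotProduct_self_eq_zero.1 hLL.symm
    apply he0
    ext i
    by_cases hi : j < (i.1 : ℕ)
    · exact he i hi
    · have h1 := htop i
      rw [hu_zero] at h1
      have h2 : σ ⟨j, hjt.trans ht⟩ ≤ σ i := hA.antitone (Fin.le_def.2 (by simpa using hi))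
      exact (mul_eq_zero.1 h1.symm).resolve_left (pow_ne_zero _ (hσ.trans_le h2).ne')
  · rw [hLL, hBL, hA.dotProduct_transpose_mulVec, div_pow, Real.sq_sqrt (by linarith),
      div_mul_eq_mul_div, div_le_iff₀ (by linarith)]
    linarith

/-- Relative convergence bounds for subspace iteration. Singular values are indexed from `0`:
`σ ⟨j, _⟩` is the `(j + 1)`-st singular value of `A`, and `σ ⟨ℓ - p, _⟩` is the `(ℓ - p + 1)`-st. -/
theorem theorem4p3 {m n k ℓ p q r : ℕ} (hnm : n ≤ m) (hk : 0 < k) (hkℓ : k ≤ ℓ) (hℓn : ℓ < n)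
    (hp : p ≤ ℓ - k)
    (A : Matrix (Fin m) (Fin n) ℝ) (U : Matrix (Fin m) (Fin n) ℝ) (σ : Fin n → ℝ)
    (V : Matrix (Fin n) (Fin n) ℝ) (hA : IsSVD A U σ V)
    (Ω : Matrix (Fin n) (Fin ℓ) ℝ)
    (hΩ : (topRows (ℓ - p) (Vᵀ * Ω)).rank = ℓ - p)
    (Q : Matrix (Fin m) (Fin r) ℝ) (B Bk : Matrix (Fin r) (Fin n) ℝ)
    (hrun : IsSubspaceIteration A Ω q k Q B Bk)
    (j : ℕ) (hj : j < k) :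
    singularValue Bk j ≤ σ ⟨j, by omega⟩ ∧
      σ ⟨j, by omega⟩ /
          √(1 + ‖bottomRows (ℓ - p) (Vᵀ * Ω)‖ ^ 2 *
            ‖pseudoInverse (topRows (ℓ - p) (Vᵀ * Ω))‖ ^ 2 *
            (σ ⟨ℓ - p, by omega⟩ / σ ⟨j, by omega⟩) ^ (4 * q + 2)) ≤
        singularValue Bk j := by
  have hjn : j < n := by omega
  obtain ⟨s, W, τ, Z, hB, -⟩ := id hrun.truncated
  have hBk : singularValue Bk j = padZero τ j := by
    rw [hrun.truncated.singularValue_eq hj, hB.singularValue_eq]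
  have hX : topRows (ℓ - p) (Vᵀ * Ω) * pseudoInverse (topRows (ℓ - p) (Vᵀ * Ω)) = 1 := by
    refine mul_eq_one_of_rank_eq_card (pseudoInverse_spec _).mul_mul_left ?_
    rw [hΩ, Fintype.card_subtype, Fin.card_filter_val_lt]
    omega
  constructor
  · have hB' := hB
    rw [hrun.eq_B] at hB'
    have := hA.singularValue_transpose_mul_le hrun.orthonormal hB' j
    rwa [← hBk, padZero.eq_1 σ, dif_pos hjn] at this
  -- If `σ j = 0`, the zero numerator makes the bound `0`, whatever value the ratio under the root
  -- takes.
  · rcases (hA.nonneg ⟨j, hjn⟩).eq_or_lt with h0 | hσ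
    · rw [← h0, zero_div]
      exact singularValue_nonneg _ _
    · rw [hBk]
      exact hrun.div_sqrt_le_padZero hA (by omega) (by omega) hσ hX hB
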